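/- Let $n\ge 0$ be an integer and let $x_1,\dots,x_{n+1}$ be distinct points of $[0,1]$. Put $g_1(x)=1$, $g_2(x)=x(1-x)$ if $n$ is even, and $g_1(x)=x$, $g_2(x)=1-x$ if $n$ is odd. Let $w_1(x)=(1,x,\dots,x^{k})^t$, $w_2(x)=(1,x,\dots,x^{k-1})^t$ if $n=2k$ (with $w_2$ the empty vector if $k=0$), and $w_1(x)=w_2(x)=(1,x,\dots,x^k)^t$ if $n=2k+1$. For $x\in\mathbb R$ define the block diagonal matrix $$B(x)=\begin{pmatrix} g_1(x)\,w_1(x)w_1(x)^t & 0\\ 0& g_2(x)\,w_2(x)w_2(x)^t\end{pmatrix}\in\mathbb R^{(n+1)\times(n+1)},$$ and put $B_r=B(x_r)$. Let $$\mathcal D=\Big\{\lambda\in\mathbb R^{n+1} : I+\sum_{r=1}^{n+1}\lambda_rB_r \text{ is positive definite}\Big\},$$ and let $C_\infty=\{\lambda\in\mathbb R^{n+1} : \mu+t\lambda\in\mathcal D \text{ for all } \mu\in\mathcal D \text{ and all } t\ge 0\}$ be its asymptotic cone. Let $l_1,\dots,l_{n+1}$ be the Lagrange interpolation polynomials of degree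 at most $n$ with $l_r(x_s)=\delta_{rs}$, and let $L(x)=(l_1(x),\dots,l_{n+1}(x))\in\mathbb R^{n+1}$. Then $$C_\infty=\mathrm{coni}\big(\{L(x) : x\in[0,1]\}\big),$$ where $\mathrm{coni}(S)$ is the conical hull of $S$, that is, the set of all finite linear combinations of elements of $S$ with non-negative coefficients. -/

import Mathlib

open Polynomial

noncomputable section

namespace SOSCone

/-- The asymptotic (recession) cone of a set `D` in a real vector space: the directions `v` such
that every ray `μ + t v`, `t ≥ 0`, issued from a point `μ` of `D` stays in `D`. -/
def asymptoticCone {E : Type*} [AddCommGroup E] [Module ℝ E] (D : Set E) : Set E :=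
  {v | ∀ μ ∈ D, ∀ t : ℝ, 0 ≤ t → μ + t • v ∈ D}

/-- The first weight on `[0,1]`: `1` for even `n`, and `X` for odd `n`. -/
def weight₁ (n : ℕ) : ℝ[X] := if Even n then 1 else X

/-- The second weight on `[0,1]`: `X (1 - X)` for even `n`, and `1 - X` for odd `n`. -/
def weight₂ (n : ℕ) : ℝ[X] := if Even n then X * (1 - X) else 1 - X

/-- The vector of monomials `(1, x, …, x^(m-1))`. -/
def monomials (m : ℕ) (x : ℝ) : Fin m → ℝ := fun i => x ^ (i : ℕ)

/-- Row and column indices of the matrices `B`. The two blocks have sizes `k + 1` and `k` if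
`n = 2 k`, and `k + 1` and `k + 1` if `n = 2 k + 1`; in both cases `n + 1` indices in all. -/
abbrev BlockIndex (n : ℕ) : Type := Fin (n / 2 + 1) ⊕ Fin ((n + 1) / 2)

/-- The block diagonal matrix `B(x) = diag (g₁(x) w₁(x) w₁(x)ᵗ, g₂(x) w₂(x) w₂(x)ᵗ)`, where
`g₁, g₂` are the weights and `w₁(x), w₂(x)` are the vectors of monomials. -/
def B (n : ℕ) (x : ℝ) : Matrix (BlockIndex n) (BlockIndex n) ℝ :=
  Matrix.fromBlocks
    ((weight₁ n).eval x •
      Matrix.vecMulVec (monomials (n / 2 + 1) x) (monomials (n / 2 + 1) x))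
    0 0
    ((weight₂ n).eval x •
      Matrix.vecMulVec (monomials ((n + 1) / 2) x) (monomials ((n + 1) / 2) x))

/-- `M(λ) = I + ∑ r, λ_r B(x_r)`. -/
def M (n : ℕ) (x : Fin (n + 1) → ℝ) (lam : Fin (n + 1) → ℝ) :
    Matrix (BlockIndex n) (BlockIndex n) ℝ :=
  1 + ∑ r, lam r • B n (x r)

/-- The domain of positive definiteness of `M`. -/
def D (n : ℕ) (x : Fin (n + 1) → ℝ) : Set (Fin (n + 1) → ℝ) :=
  {lam | (M n x lam).PosDef}

/-- The Lagrange vector `L(z) = (l_r(z))_r`, where `l_r` is the Lagrange interpolation polynomial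
of degree at most `n` with `l_r(x_s) = δ_{rs}`. -/
def lagrangeVector (n : ℕ) (x : Fin (n + 1) → ℝ) (z : ℝ) : Fin (n + 1) → ℝ :=
  fun r => (Lagrange.basis Finset.univ x r).eval z

end SOSCone

end

namespace SOSCone

/-! Put ℓ(P) = ∑ λ_r P(x_r). On coefficient vectors of p and q, the quadratic form of ∑ λ_r B_r is
ℓ(g₁p² + g₂q²), and since 0 lies in the domain, λ is a recession direction iff this form is positive
semidefinite (`mem_asymptoticCone_iff`). By the Markov–Lukács theorem (`mem_sosCone_of_nonneg`,
`nonneg_on_sosCone`) ℓ is then nonnegative on every polynomial of degree at most n that is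
nonnegative on [0,1]. On degree at most n, evaluation at z is the functional with λ = L(z). So the
conical hull lies in the cone because B(z) is positive semidefinite on [0,1]; conversely, after
normalizing ℓ(1) = 1, a λ outside the compact convex hull of the L(z) would be separated from it by
a polynomial contradicting positivity of ℓ. -/

/-! ### Nonnegative polynomials on [0,1] as weighted sums of squares -/

/-- Products `X ^ i * (1 - X) ^ j * p ^ 2` of formal degree at most `n`. -/
def weightedSquares (n : ℕ) : Set ℝ[X] :=
  {P | ∃ (i j : ℕ) (p : ℝ[X]), i + j + 2 * p.natDegree ≤ n ∧ P = X ^ i * (1 - X) ^ j * p ^ 2}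

/-- Finite sums of weighted squares of formal degree at most `n`. -/
noncomputable def sosCone (n : ℕ) : AddSubmonoid ℝ[X] := AddSubmonoid.closure (weightedSquares n)

open scoped Pointwise in
lemma mul_mem_sosCone {m n : ℕ} {P Q : ℝ[X]} (hP : P ∈ sosCone m) (hQ : Q ∈ sosCone n) :
    P * Q ∈ sosCone (m + n) := by
  have h : P * Q ∈ sosCone m * sosCone n := AddSubmonoid.mul_mem_mul hP hQ
  rw [sosCone, sosCone, AddSubmonoid.closure_mul_closure] at h
  refine AddSubmonoid.closure_mono ?_ h
  rintro _ ⟨_, ⟨i, j, p, hp, rfl⟩, _, ⟨i', j', q, hq, rfl⟩, rfl⟩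
  refine ⟨i + i', j + j', p * q, ?_, by ring⟩
  have := natDegree_mul_le (p := p) (q := q)
  lia

lemma weightedSquare_mem_sosCone {n : ℕ} (i j : ℕ) (p : ℝ[X])
    (h : i + j + 2 * p.natDegree ≤ n) : X ^ i * (1 - X) ^ j * p ^ 2 ∈ sosCone n :=
  AddSubmonoid.subset_closure ⟨i, j, p, h, rfl⟩

lemma sq_mem_sosCone {n : ℕ} (p : ℝ[X]) (h : 2 * p.natDegree ≤ n) : p ^ 2 ∈ sosCone n := by
  simpa using weightedSquare_mem_sosCone 0 0 p (by simpa using h)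

lemma C_mem_sosCone {n : ℕ} {c : ℝ} (hc : 0 ≤ c) : C c ∈ sosCone n := by
  have h := sq_mem_sosCone (n := n) (C (√c)) (by simp)
  rwa [← C_pow, Real.sq_sqrt hc] at h

/-- A linear polynomial with nonnegative values `a` at `0` and `b` at `1`. -/
lemma linear_mem_sosCone {a b : ℝ} (ha : 0 ≤ a) (hb : 0 ≤ b) :
    C a * (1 - X) + C b * X ∈ sosCone 1 := by
  have h0 := weightedSquare_mem_sosCone (n := 1) 0 1 (C (√a)) (by simp)
  have h1 := weightedSquare_mem_sosCone (n := 1) 1 0 (C (√b)) (by simp)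
  rw [← C_pow, Real.sq_sqrt ha] at h0
  rw [← C_pow, Real.sq_sqrt hb] at h1
  convert! add_mem h0 h1 using 1
  ring

lemma eval_nonneg_of_eval_nonneg_off_point {Q : ℝ[X]} (a : ℝ)
    (h : ∀ z ∈ Set.Ioo (0 : ℝ) 1, z ≠ a → 0 ≤ Q.eval z) :
    ∀ z ∈ Set.Icc (0 : ℝ) 1, 0 ≤ Q.eval z := by
  intro z hz
  have hd := (dense_compl_singleton a).open_subset_closure_inter (isOpen_Ioo (a := (0 : ℝ)) (b := 1))
  have hz' : z ∈ closure (Set.Ioo (0 : ℝ) 1 ∩ {a}ᶜ) := by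
    rw [← closure_Ioo (zero_ne_one' ℝ)] at hz
    exact closure_minimal hd isClosed_closure hz
  exact closure_minimal (t := {z | 0 ≤ Q.eval z}) (fun y hy => h y hy.1 hy.2)
    (isClosed_le continuous_const Q.continuous) hz'

lemma natDegree_eq_add_of_eq_mul {P A Q : ℝ[X]} (hP : P ≠ 0) (h : P = A * Q) :
    P.natDegree = A.natDegree + Q.natDegree := by
  subst h
  exact natDegree_mul (left_ne_zero_of_mul hP) (right_ne_zero_of_mul hP)

/-- A polynomial that is nonnegative on `[0,1]` is a sum of weighted squares. -/
theorem mem_sosCone_of_nonneg (n : ℕ) : ∀ P : ℝ[X], P.natDegree ≤ n →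
    (∀ z ∈ Set.Icc (0 : ℝ) 1, 0 ≤ P.eval z) → P ∈ sosCone n := by
  induction n using Nat.strong_induction_on with
  | _ n ih =>
  intro P hdeg hP
  rcases Nat.eq_zero_or_pos P.natDegree with h0 | hpos
  · rw [eq_C_of_natDegree_eq_zero h0] at hP ⊢
    exact C_mem_sosCone (by simpa using hP 0 (by simp))
  have hP0 : P ≠ 0 := by rintro rfl; simp at hpos
  -- Induction step: split off a factor A that is positive on (0,1) except perhaps at a; the
  -- cofactor is nonnegative there, hence on [0,1] by density.
  have reduce : ∀ (d : ℕ) (A Q : ℝ[X]) (a : ℝ), 1 ≤ d → A.natDegree = d → A ∈ sosCone d →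
      P = A * Q → (∀ z ∈ Set.Ioo (0 : ℝ) 1, z ≠ a → 0 < A.eval z) → P ∈ sosCone n := by
    intro d A Q a hd hA hmem hPQ hApos
    have hdegs := natDegree_eq_add_of_eq_mul hP0 hPQ
    have hQ : Q ∈ sosCone (n - d) := by
      refine ih _ (by lia) _ (by lia) (eval_nonneg_of_eval_nonneg_off_point a fun z hz hza => ?_)
      have := hP z ⟨hz.1.le, hz.2.le⟩
      rw [hPQ, eval_mul] at this
      exact nonneg_of_mul_nonneg_right this (hApos z hz hza)
    have := mul_mem_sosCone hmem hQ
    rwa [← hPQ, show d + (n - d) = n by lia] at this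
  obtain ⟨c, hc⟩ := Complex.exists_root (f := P.map (algebraMap ℝ ℂ))
    (by rw [degree_map]; exact natDegree_pos_iff_degree_pos.1 hpos)
  have hc : aeval c P = 0 := by rwa [IsRoot.def, eval_map_algebraMap] at hc
  by_cases him : c.im = 0
  · obtain ⟨a, rfl⟩ : ∃ a : ℝ, c = a := ⟨c.re, by apply Complex.ext <;> simp [him]⟩
    have ha : P.eval a = 0 := by
      have : aeval (algebraMap ℝ ℂ a) P = 0 := hc
      rwa [aeval_algebraMap_apply, map_eq_zero, coe_aeval_eq_eval] at this
    obtain ⟨Q, hQ⟩ := dvd_iff_isRoot.2 ha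
    rcases le_or_gt a 0 with ha0 | ha0
    · refine reduce 1 (X - C a) Q a le_rfl (natDegree_X_sub_C a) ?_ hQ ?_
      · convert! linear_mem_sosCone (a := -a) (b := 1 - a) (by linarith) (by linarith) using 1
        simp; ring
      · intro z hz _
        simp; linarith [hz.1]
    rcases le_or_gt 1 a with ha1 | ha1
    · refine reduce 1 (C a - X) (-Q) a le_rfl ?_ ?_ (by rw [hQ]; ring) ?_
      · rw [← neg_sub, natDegree_neg, natDegree_X_sub_C]
      · convert! linear_mem_sosCone (a := a) (b := a - 1) (by linarith) (by linarith) using 1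
        simp; ring
      · intro z hz _
        simp; linarith [hz.2]
    -- An interior root is a local minimum, so P' vanishes there and the root is at least double.
    have hmin : IsLocalMin (fun z => P.eval z) a := by
      filter_upwards [Icc_mem_nhds ha0 ha1] with z hz
      rw [ha]; exact hP z hz
    have hder := hmin.hasDerivAt_eq_zero (P.hasDerivAt a)
    have hQa : Q.eval a = 0 := by
      rw [hQ] at hder
      simpa using hder
    obtain ⟨R, hR⟩ := dvd_iff_isRoot.2 hQa
    refine reduce 2 ((X - C a) ^ 2) R a one_le_two (by simp) (sq_mem_sosCone _ (by simp))
      (by rw [hQ, hR]; ring) ?_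
    intro z _ hza
    have : z - a ≠ 0 := sub_ne_zero.2 hza
    simp; positivity
  · obtain ⟨Q, hQ⟩ := P.quadratic_dvd_of_aeval_eq_zero_im_ne_zero hc him
    have hquad : (X ^ 2 - C (2 * c.re) * X + C (‖c‖ ^ 2) : ℝ[X]) =
        (X - C c.re) ^ 2 + C (c.im ^ 2) := by
      rw [Complex.sq_norm, Complex.normSq_apply]
      simp only [C_add, C_mul, C_pow]
      rw [show (C (2 : ℝ) : ℝ[X]) = 2 from rfl]
      ring
    rw [hquad] at hQ
    -- The excluded point 0 is a dummy: this quadratic has no real root.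
    refine reduce 2 _ Q 0 one_le_two ?_
      (add_mem (sq_mem_sosCone _ (by simp)) (C_mem_sosCone (sq_nonneg _))) hQ ?_
    · rw [natDegree_add_C]; simp
    · intro z _ _
      simp; positivity

/-- A functional that is nonnegative on the two families of weighted squares adapted to the parity
of `n` is nonnegative on all weighted squares of formal degree at most `n`. -/
lemma nonneg_on_sosCone {n : ℕ} (ℓ : ℝ[X] →ₗ[ℝ] ℝ)
    (h₁ : ∀ p : ℝ[X], p.natDegree < n / 2 + 1 → 0 ≤ ℓ (weight₁ n * p ^ 2))
    (h₂ : ∀ p : ℝ[X], p.natDegree < (n + 1) / 2 → 0 ≤ ℓ (weight₂ n * p ^ 2)) :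
    ∀ P ∈ sosCone n, 0 ≤ ℓ P := by
  intro P hP
  induction hP using AddSubmonoid.closure_induction with
  | zero => simp
  | add P Q _ _ hP hQ => rw [map_add]; exact add_nonneg hP hQ
  | mem P hP =>
  obtain ⟨i, j, p, hdeg, rfl⟩ := hP
  have hX : ∀ (a b : ℕ) (q : ℝ[X]), (X ^ a * (1 - X) ^ b * q).natDegree ≤ a + b + q.natDegree := by
    intro a b q
    have : (1 - X : ℝ[X]).natDegree ≤ 1 := by compute_degree
    have h1 := natDegree_pow_le_of_le b this
    have h2 := natDegree_mul_le (p := X ^ a * (1 - X : ℝ[X]) ^ b) (q := q)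
    have h3 := natDegree_mul_le (p := (X : ℝ[X]) ^ a) (q := (1 - X : ℝ[X]) ^ b)
    have h4 : ((X : ℝ[X]) ^ a).natDegree = a := natDegree_X_pow a
    lia
  obtain ⟨a, ha⟩ := Nat.even_or_odd' i
  obtain ⟨b, hb⟩ := Nat.even_or_odd' j
  have hq := hX a b p
  have hqx := hX (a + 1) b p
  have hqy := hX a (b + 1) p
  rcases Nat.even_or_odd n with hn | hn
  · obtain ⟨k, hk⟩ := id hn
    simp only [weight₁, weight₂, if_pos hn] at h₁ h₂
    rcases ha with rfl | rfl <;> rcases hb with rfl | rfl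
    · convert! h₁ (X ^ a * (1 - X) ^ b * p) (by lia) using 2
      ring
    -- When i + j and n differ in parity, one degree is to spare, and multiplying by 1 = X + (1 - X)
    -- yields the two admissible weights.
    · convert! add_nonneg (h₁ (X ^ a * (1 - X) ^ (b + 1) * p) (by lia))
        (h₂ (X ^ a * (1 - X) ^ b * p) (by lia)) using 1
      rw [← map_add]; congr 1; ring
    · convert! add_nonneg (h₁ (X ^ (a + 1) * (1 - X) ^ b * p) (by lia))
        (h₂ (X ^ a * (1 - X) ^ b * p) (by lia)) using 1
      rw [← map_add]; congr 1; ring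
    · convert! h₂ (X ^ a * (1 - X) ^ b * p) (by lia) using 2
      ring
  · obtain ⟨k, hk⟩ := id hn
    simp only [weight₁, weight₂, if_neg (Nat.not_even_iff_odd.2 hn)] at h₁ h₂
    rcases ha with rfl | rfl <;> rcases hb with rfl | rfl
    · convert! add_nonneg (h₁ (X ^ a * (1 - X) ^ b * p) (by lia))
        (h₂ (X ^ a * (1 - X) ^ b * p) (by lia)) using 1
      rw [← map_add]; congr 1; ring
    · convert! h₂ (X ^ a * (1 - X) ^ b * p) (by lia) using 2
      ring
    · convert! h₁ (X ^ a * (1 - X) ^ b * p) (by lia) using 2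
      ring
    · convert! add_nonneg (h₁ (X ^ a * (1 - X) ^ (b + 1) * p) (by lia))
        (h₂ (X ^ (a + 1) * (1 - X) ^ b * p) (by lia)) using 1
      rw [← map_add]; congr 1; ring

/-! ### Compactness of convex hulls -/

/-- In finite dimension the convex hull of a compact set is compact. -/
theorem isCompact_convexHull {E : Type*} [AddCommGroup E] [Module ℝ E] [TopologicalSpace E]
    [ContinuousAdd E] [ContinuousSMul ℝ E] [FiniteDimensional ℝ E] {s : Set E} (hs : IsCompact s) :
    IsCompact (convexHull ℝ s) := by
  set d := Module.finrank ℝ E + 1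
  let f : (Fin d → ℝ) × (Fin d → E) → E := fun q => ∑ i, q.1 i • q.2 i
  have hf : Continuous f := by fun_prop
  have hc : IsCompact (f '' (stdSimplex ℝ (Fin d) ×ˢ Set.univ.pi fun _ => s)) :=
    ((isCompact_stdSimplex ℝ (Fin d)).prod (isCompact_univ_pi fun _ => hs)).image hf
  convert! hc using 1
  apply Set.Subset.antisymm
  · intro y hy
    obtain ⟨ι, _, z, w, hz, hai, hw, hw1, hsum⟩ := eq_pos_convex_span_of_mem_convexHull hy
    have hcard : Fintype.card ι ≤ Fintype.card (Fin d) := by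
      simpa using hai.card_le_finrank_succ.trans (Nat.succ_le_succ (Submodule.finrank_le _))
    obtain ⟨e⟩ := Function.Embedding.nonempty_of_card_le hcard
    obtain ⟨z₀, hz₀⟩ : s.Nonempty := convexHull_nonempty_iff.1 ⟨y, hy⟩
    -- Carathéodory gives at most dim + 1 points; pad with weight 0 at an arbitrary point of s.
    refine ⟨(Function.extend e w 0, Function.extend e z fun _ => z₀), ⟨⟨?_, ?_⟩, ?_⟩, ?_⟩
    · intro i
      by_cases hi : ∃ j, e j = i
      · obtain ⟨j, rfl⟩ := hi
        simpa [e.injective.extend_apply] using (hw j).le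
      · simp [Function.extend_apply' _ _ _ hi]
    · rw [← hw1]
      refine (Fintype.sum_of_injective e e.injective w _ ?_ ?_).symm
      · intro i hi
        exact Function.extend_apply' _ _ _ hi
      · intro i
        exact (e.injective.extend_apply _ _ _).symm
    · intro i _
      by_cases hi : ∃ j, e j = i
      · obtain ⟨j, rfl⟩ := hi
        simpa [e.injective.extend_apply] using hz ⟨j, rfl⟩
      · simpa [Function.extend_apply' _ _ _ hi] using hz₀
    · rw [← hsum]
      refine (Fintype.sum_of_injective e e.injective (fun i => w i • z i) _ ?_ ?_).symm
      · intro i hi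
        simp [Function.extend_apply' w _ _ hi]
      · intro i
        simp [e.injective.extend_apply]
  · rintro _ ⟨⟨w, z⟩, ⟨⟨hw0, hw1⟩, hz⟩, rfl⟩
    exact (convex_convexHull ℝ s).sum_mem (fun i _ => hw0 i) hw1
      fun i _ => subset_convexHull ℝ s (hz i trivial)

/-! ### The matrix pencil and its recession cone -/

/-- The functional `P ↦ ∑ r, lam r * P(x r)`. -/
noncomputable def nodalFunctional {n : ℕ} (x lam : Fin (n + 1) → ℝ) : ℝ[X] →ₗ[ℝ] ℝ :=
  ∑ r, lam r • leval (x r)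

lemma nodalFunctional_apply {n : ℕ} (x lam : Fin (n + 1) → ℝ) (P : ℝ[X]) :
    nodalFunctional x lam P = ∑ r, lam r * P.eval (x r) := by
  simp [nodalFunctional, leval]

lemma dotProduct_B_mulVec (n : ℕ) (z : ℝ) (u : Fin (n / 2 + 1) → ℝ) (v : Fin ((n + 1) / 2) → ℝ) :
    Sum.elim u v ⬝ᵥ (B n z).mulVec (Sum.elim u v) =
      (weight₁ n).eval z * (monomials _ z ⬝ᵥ u) ^ 2 +
        (weight₂ n).eval z * (monomials _ z ⬝ᵥ v) ^ 2 := by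
  rw [B, Matrix.fromBlocks_mulVec, sumElim_dotProduct_sumElim]
  simp [Matrix.smul_mulVec, Matrix.vecMulVec_mulVec, dotProduct_comm u, dotProduct_comm v]
  ring

lemma isHermitian_B (n : ℕ) (z : ℝ) : (B n z).IsHermitian := by
  ext i j
  rcases i with i | i <;> rcases j with j | j <;> simp [B, Matrix.vecMulVec_apply, mul_comm]

lemma weight₁_eval_nonneg (n : ℕ) {z : ℝ} (hz : z ∈ Set.Icc (0 : ℝ) 1) :
    0 ≤ (weight₁ n).eval z := by
  unfold weight₁
  split_ifs <;> simp [hz.1]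

lemma weight₂_eval_nonneg (n : ℕ) {z : ℝ} (hz : z ∈ Set.Icc (0 : ℝ) 1) :
    0 ≤ (weight₂ n).eval z := by
  unfold weight₂
  split_ifs
  · simpa using mul_nonneg hz.1 (sub_nonneg.2 hz.2)
  · simpa using hz.2

lemma posSemidef_B (n : ℕ) {z : ℝ} (hz : z ∈ Set.Icc (0 : ℝ) 1) : (B n z).PosSemidef := by
  refine .of_dotProduct_mulVec_nonneg (isHermitian_B n z) fun v => ?_
  rw [star_trivial, ← Sum.elim_comp_inl_inr v, dotProduct_B_mulVec]
  have := weight₁_eval_nonneg n hz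
  have := weight₂_eval_nonneg n hz
  positivity

lemma monomials_dotProduct_coeff {m : ℕ} (z : ℝ) {p : ℝ[X]} (hp : p.natDegree < m) :
    (monomials m z ⬝ᵥ fun i => p.coeff i) = p.eval z := by
  rw [eval_eq_sum_range' hp, Finset.sum_range, dotProduct]
  exact Finset.sum_congr rfl fun i _ => mul_comm _ _

/-- The linear part of `M`. -/
noncomputable def linearPart (n : ℕ) (x lam : Fin (n + 1) → ℝ) :
    Matrix (BlockIndex n) (BlockIndex n) ℝ :=
  ∑ r, lam r • B n (x r)

lemma isHermitian_linearPart (n : ℕ) (x lam : Fin (n + 1) → ℝ) :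
    (linearPart n x lam).IsHermitian := by
  unfold linearPart
  rw [Matrix.IsHermitian, Matrix.conjTranspose_sum]
  exact Finset.sum_congr rfl fun r _ => by
    rw [Matrix.conjTranspose_smul, (isHermitian_B n (x r)).eq, star_trivial]

lemma dotProduct_linearPart_mulVec (n : ℕ) (x lam : Fin (n + 1) → ℝ) (v : BlockIndex n → ℝ) :
    v ⬝ᵥ (linearPart n x lam).mulVec v = ∑ r, lam r * (v ⬝ᵥ (B n (x r)).mulVec v) := by
  simp [linearPart, Matrix.sum_mulVec, dotProduct_sum, Matrix.smul_mulVec]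

lemma M_add_smul (n : ℕ) (x μ lam : Fin (n + 1) → ℝ) (t : ℝ) :
    M n x (μ + t • lam) = M n x μ + t • linearPart n x lam := by
  simp [M, linearPart, add_smul, Finset.sum_add_distrib, Finset.smul_sum, mul_smul, add_assoc]

theorem mem_asymptoticCone_iff (n : ℕ) (x lam : Fin (n + 1) → ℝ) :
    lam ∈ asymptoticCone (D n x) ↔ (linearPart n x lam).PosSemidef := by
  constructor
  · intro h
    have h0 : (0 : Fin (n + 1) → ℝ) ∈ D n x := by
      simpa [D, M] using Matrix.PosDef.one
    refine .of_dotProduct_mulVec_nonneg (isHermitian_linearPart n x lam) fun v => ?_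
    rw [star_trivial]
    have key : ∀ t : ℝ, 0 ≤ t → 0 ≤ v ⬝ᵥ v + t * (v ⬝ᵥ (linearPart n x lam).mulVec v) := by
      intro t ht
      have h1 : (M n x (0 + t • lam)).PosDef := h 0 h0 t ht
      have h2 := h1.posSemidef.dotProduct_mulVec_nonneg v
      rw [M_add_smul] at h2
      simpa [M, Matrix.add_mulVec, Matrix.smul_mulVec] using h2
    by_contra! hneg
    have hv : 0 ≤ v ⬝ᵥ v := Finset.sum_nonneg fun i _ => mul_self_nonneg (v i)
    -- This t makes the expression in `key` equal to -1.
    have h1 := key ((v ⬝ᵥ v + 1) / -(v ⬝ᵥ (linearPart n x lam).mulVec v))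
      (div_nonneg (by linarith) (by linarith))
    have h2 : (v ⬝ᵥ v + 1) / -(v ⬝ᵥ (linearPart n x lam).mulVec v) *
        (v ⬝ᵥ (linearPart n x lam).mulVec v) = -(v ⬝ᵥ v + 1) := by
      rw [div_neg, neg_mul, div_mul_cancel₀ _ hneg.ne]
    linarith
  · intro h μ hμ t ht
    change (M n x (μ + t • lam)).PosDef
    rw [M_add_smul]
    exact Matrix.PosDef.add_posSemidef hμ (h.smul ht)

/-- The weights and block sizes are matched so that both blocks have entries of degree at most n,
hence interpolated exactly by the n + 1 nodes. -/
lemma exists_polynomial_entry (n : ℕ) (i j : BlockIndex n) :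
    ∃ F : ℝ[X], F.natDegree ≤ n ∧ ∀ z, B n z i j = F.eval z := by
  rcases i with i | i <;> rcases j with j | j
  · refine ⟨weight₁ n * X ^ (i + j : ℕ), ?_, fun z => ?_⟩
    · unfold weight₁
      have := i.2
      have := j.2
      split_ifs with h
      · simp; lia
      · have := Nat.not_even_iff_odd.1 h
        rw [← pow_succ', natDegree_X_pow]
        grind
    · simp [B, Matrix.vecMulVec_apply, monomials, pow_add]
  · exact ⟨0, by simp, by simp [B]⟩
  · exact ⟨0, by simp, by simp [B]⟩
  · refine ⟨weight₂ n * X ^ (i + j : ℕ), ?_, fun z => ?_⟩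
    · refine natDegree_mul_le.trans ?_
      rw [natDegree_X_pow]
      unfold weight₂
      have := i.2
      have := j.2
      split_ifs with h
      · have : (X * (1 - X) : ℝ[X]).natDegree ≤ 2 := by compute_degree
        grind
      · have : (1 - X : ℝ[X]).natDegree ≤ 1 := by compute_degree
        have := Nat.not_even_iff_odd.1 h
        grind
    · simp [B, Matrix.vecMulVec_apply, monomials, pow_add]

/-! ### Interpolation and duality -/

section Interpolation

variable {n : ℕ} {x : Fin (n + 1) → ℝ}

lemma sum_eval_mul_lagrangeVector (hx : Function.Injective x) {F : ℝ[X]} (hF : F.natDegree ≤ n)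
    (z : ℝ) : ∑ r, F.eval (x r) * lagrangeVector n x z r = F.eval z := by
  have hdeg : F.degree < (Finset.univ : Finset (Fin (n + 1))).card := by
    rw [Finset.card_univ, Fintype.card_fin]
    exact degree_le_natDegree.trans_lt (by exact_mod_cast Nat.lt_succ_of_le hF)
  conv_rhs => rw [Lagrange.eq_interpolate hx.injOn hdeg, Lagrange.interpolate_apply]
  simp [eval_finsetSum, lagrangeVector]

lemma linearPart_lagrangeVector (hx : Function.Injective x) (z : ℝ) :
    linearPart n x (lagrangeVector n x z) = B n z := by
  ext i j
  obtain ⟨F, hF, hB⟩ := exists_polynomial_entry n i j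
  rw [hB z, ← sum_eval_mul_lagrangeVector hx hF z]
  simp [linearPart, Matrix.sum_apply, hB, mul_comm]

lemma continuous_lagrangeVector : Continuous (lagrangeVector n x) :=
  continuous_pi fun _ => Polynomial.continuous _

lemma hull_subset_asymptoticCone (hx : Function.Injective x) :
    (PointedCone.hull ℝ (lagrangeVector n x '' Set.Icc (0 : ℝ) 1) : Set (Fin (n + 1) → ℝ)) ⊆
      asymptoticCone (D n x) := by
  intro lam hlam
  induction hlam using Submodule.span_induction with
  | mem v hv =>
    obtain ⟨z, hz, rfl⟩ := hv
    rw [mem_asymptoticCone_iff, linearPart_lagrangeVector hx]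
    exact posSemidef_B n hz
  | zero => intro μ hμ t _; simpa using hμ
  | add u v _ _ hu hv =>
    intro μ hμ t ht
    rw [smul_add, ← add_assoc]
    exact hv _ (hu _ hμ t ht) t ht
  | smul a v _ hv =>
    intro μ hμ t ht
    have := hv μ hμ (t * a) (mul_nonneg ht a.2)
    rwa [mul_smul] at this

lemma nodalFunctional_nonneg_of_posSemidef {lam : Fin (n + 1) → ℝ}
    (h : (linearPart n x lam).PosSemidef) {P : ℝ[X]} (hdeg : P.natDegree ≤ n)
    (hP : ∀ z ∈ Set.Icc (0 : ℝ) 1, 0 ≤ P.eval z) : 0 ≤ nodalFunctional x lam P := by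
  refine nonneg_on_sosCone _ (fun p hp => ?_) (fun p hp => ?_) P (mem_sosCone_of_nonneg n P hdeg hP)
  · have := h.dotProduct_mulVec_nonneg (Sum.elim (fun i : Fin (n / 2 + 1) => p.coeff i) 0)
    rw [star_trivial, dotProduct_linearPart_mulVec] at this
    simpa [dotProduct_B_mulVec, monomials_dotProduct_coeff _ hp, nodalFunctional_apply] using this
  · have := h.dotProduct_mulVec_nonneg (Sum.elim 0 (fun i : Fin ((n + 1) / 2) => p.coeff i))
    rw [star_trivial, dotProduct_linearPart_mulVec] at this
    simpa [dotProduct_B_mulVec, monomials_dotProduct_coeff _ hp, nodalFunctional_apply] using this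

lemma nodalFunctional_interpolate (hx : Function.Injective x) (lam f : Fin (n + 1) → ℝ) :
    nodalFunctional x lam (Lagrange.interpolate Finset.univ x f) = ∑ r, lam r * f r := by
  rw [nodalFunctional_apply]
  exact Finset.sum_congr rfl fun r _ => by
    rw [Lagrange.eval_interpolate_at_node f hx.injOn (Finset.mem_univ r)]

lemma natDegree_interpolate_le (hx : Function.Injective x) (f : Fin (n + 1) → ℝ) :
    (Lagrange.interpolate Finset.univ x f).natDegree ≤ n := by
  have := Lagrange.degree_interpolate_le (s := Finset.univ) f hx.injOn
  exact natDegree_le_of_degree_le (by simpa using this)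

lemma eval_interpolate (f : Fin (n + 1) → ℝ) (z : ℝ) :
    (Lagrange.interpolate Finset.univ x f).eval z = ∑ r, f r * lagrangeVector n x z r := by
  simp [Lagrange.interpolate_apply, eval_finsetSum, lagrangeVector]

/-- A functional that is nonnegative on nonnegative polynomials and vanishes at `1` is zero. -/
lemma eq_zero_of_nonneg_of_sum_eq_zero (hx : Function.Injective x) {lam : Fin (n + 1) → ℝ}
    (h : ∀ P : ℝ[X], P.natDegree ≤ n → (∀ z ∈ Set.Icc (0 : ℝ) 1, 0 ≤ P.eval z) →
      0 ≤ nodalFunctional x lam P) (hsum : ∑ r, lam r = 0) : lam = 0 := by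
  have nonneg : ∀ P : ℝ[X], P.natDegree ≤ n → 0 ≤ nodalFunctional x lam P := by
    intro P hP
    -- As ℓ(1) = 0, subtracting a lower bound on [0,1] leaves ℓ(P) unchanged, so the sign of P is
    -- irrelevant.
    obtain ⟨b, hb⟩ := (isCompact_Icc (a := (0 : ℝ)) (b := 1)).bddBelow_image P.continuous.continuousOn
    have h1 := h (P - C b) (by rwa [natDegree_sub_C]) fun z hz => by
      simpa using hb ⟨z, hz, rfl⟩
    have h2 : nodalFunctional x lam (C b) = 0 := by
      simp [nodalFunctional_apply, ← Finset.sum_mul, hsum]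
    rwa [map_sub, h2, sub_zero] at h1
  funext r
  have hr := nodalFunctional_interpolate hx lam (Pi.single r 1)
  have h1 := nonneg _ (natDegree_interpolate_le hx (Pi.single r 1))
  have h2 := nonneg (-Lagrange.interpolate Finset.univ x (Pi.single r 1))
    (by rw [natDegree_neg]; exact natDegree_interpolate_le hx _)
  rw [map_neg] at h2
  simp only [Pi.single_apply, mul_ite, mul_one, mul_zero, Finset.sum_ite_eq', Finset.mem_univ,
    if_true] at hr
  rw [Pi.zero_apply]
  linarith

/-- A functional of total mass one that is nonnegative on nonnegative polynomials is a convex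
combination of point evaluations on `[0,1]`. -/
lemma mem_convexHull_of_nonneg (hx : Function.Injective x) {lam : Fin (n + 1) → ℝ}
    (h : ∀ P : ℝ[X], P.natDegree ≤ n → (∀ z ∈ Set.Icc (0 : ℝ) 1, 0 ≤ P.eval z) →
      0 ≤ nodalFunctional x lam P) (hsum : ∑ r, lam r = 1) :
    lam ∈ convexHull ℝ (lagrangeVector n x '' Set.Icc (0 : ℝ) 1) := by
  by_contra hnot
  have hcl : IsClosed (convexHull ℝ (lagrangeVector n x '' Set.Icc (0 : ℝ) 1)) :=
    (isCompact_convexHull (isCompact_Icc.image continuous_lagrangeVector)).isClosed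
  obtain ⟨g, u, hgu, hug⟩ := geometric_hahn_banach_point_closed (convex_convexHull ℝ _) hcl hnot
  set f : Fin (n + 1) → ℝ := fun r => g (Pi.single r 1)
  have hg : ∀ y, g y = ∑ r, f r * y r := by
    intro y
    conv_lhs => rw [pi_eq_sum_univ' y]
    rw [map_sum]
    refine Finset.sum_congr rfl fun r _ => ?_
    rw [map_smul, smul_eq_mul, mul_comm]
  -- The interpolant of f has value g(L(z)) > u at z in [0,1], while ℓ sends it to g(λ) < u.
  have h1 := h (Lagrange.interpolate Finset.univ x f - C u)
    (by rw [natDegree_sub_C]; exact natDegree_interpolate_le hx f) fun z hz => by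
      have := hug _ (subset_convexHull ℝ _ ⟨z, hz, rfl⟩)
      rw [hg] at this
      rw [eval_sub, eval_C, eval_interpolate]
      linarith
  rw [map_sub, nodalFunctional_interpolate hx, nodalFunctional_apply] at h1
  simp only [eval_C, ← Finset.sum_mul, hsum, one_mul] at h1
  rw [hg] at hgu
  simp only [mul_comm] at h1 hgu
  linarith

end Interpolation

end SOSCone

theorem theoremt (n : ℕ) (x : Fin (n + 1) → ℝ) (hx : Function.Injective x)
    (hx01 : ∀ r, x r ∈ Set.Icc (0 : ℝ) 1) :
    SOSCone.asymptoticCone (SOSCone.D n x) =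
      (PointedCone.hull ℝ (SOSCone.lagrangeVector n x '' Set.Icc (0 : ℝ) 1) :
        Set (Fin (n + 1) → ℝ)) := by
  open SOSCone in
  refine Set.Subset.antisymm (fun lam hlam => ?_) (hull_subset_asymptoticCone hx)
  rw [mem_asymptoticCone_iff] at hlam
  have h : ∀ P : ℝ[X], P.natDegree ≤ n → (∀ z ∈ Set.Icc (0 : ℝ) 1, 0 ≤ P.eval z) →
      0 ≤ nodalFunctional x lam P :=
    fun P hdeg hP => nodalFunctional_nonneg_of_posSemidef hlam hdeg hP
  have hs : 0 ≤ ∑ r, lam r := by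
    simpa [nodalFunctional_apply] using h 1 (by simp) (by simp)
  -- The total mass is ℓ(1); if positive, rescale to mass one.
  rcases hs.eq_or_lt with hs | hs
  · rw [eq_zero_of_nonneg_of_sum_eq_zero hx h hs.symm]
    exact zero_mem (PointedCone.hull ℝ (lagrangeVector n x '' Set.Icc (0 : ℝ) 1))
  · set s := ∑ r, lam r
    have hmem := mem_convexHull_of_nonneg hx (lam := s⁻¹ • lam) (fun P hdeg hP => by
      have h1 := mul_nonneg (inv_nonneg.2 hs.le) (h P hdeg hP)
      simpa [nodalFunctional_apply, Finset.mul_sum, mul_assoc] using h1)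
      (by simp only [Pi.smul_apply, smul_eq_mul, ← Finset.mul_sum]; exact inv_mul_cancel₀ hs.ne')
    have hhull := convexHull_min (PointedCone.subset_hull (R := ℝ))
      (PointedCone.hull ℝ (lagrangeVector n x '' Set.Icc (0 : ℝ) 1)).convex hmem
    have := Submodule.smul_mem _ (⟨s, hs.le⟩ : NNReal) hhull
    convert! this using 1
    change lam = s • s⁻¹ • lam
    rw [smul_inv_smul₀ hs.ne']
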